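/- **Setting.** Let $K$ be a field, $R=K[x_1]$ and $A=R[\tilde{x}]$ with finitely many further variables $\tilde x=(x_2,\dots ,x_N)$. Fix an elimination ordering on the monomials of $A$ ($\tilde x$ larger than $x_1$), i.e. a monomial ordering $\succ$ on the monomials in $\tilde x$ by which one compares first, and then the exponents of $x_1$. For a polynomial $f\neq 0$ in $\tilde x$ over a coefficient ring, $\mathrm{lm}(f)$ is the largest monomial in $\tilde x$ occurring in $f$, $\mathrm{lc}(f)$ is its coefficient, $\mathrm{lt}(f)=\mathrm{lc}(f)\,\mathrm{lm}(f)$; $\mathrm{lm}(0)$ counts as smaller than every monomial, and products with it as $\mathrm{lm}(0)$. "Constant" means lying in $K$. *Pseudo-division.* A pseudo-division of $f\in A$ by a finite set $G\subset A\setminus R$ with multiplier $\lambda\in R\setminus\{0\}$ and remainder $r$ is an identity $\lambda f=\sum_{b\in G}q_b b+r$ such that no monomial (in $\tilde x$) of $r$ is divisible by any $\mathrm{lm}(b)$, $b\in G$, and $\mathrm{lm}(f)=\max\{\max_b \mathrm{lm}(q_b b),\mathrm{lm}(r)\}$. *$S$-polynomials.* For $f,g\in A\setminus R$ put $S(f,g)=\frac{c\,\tilde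 x^{\gamma}}{\mathrm{lt}(f)}f-\frac{c\,\tilde x^{\gamma}}{\mathrm{lt}(g)}g$, where $c=\mathrm{lcm}(\mathrm{lc}(f),\mathrm{lc}(g))$ and $\tilde x^{\gamma}=\mathrm{lcm}(\mathrm{lm}(f),\mathrm{lm}(g))$. *Algorithm.* The input is a finite set $F\subset A\setminus K$. Start with $G:=F\setminus R$, $f_0:=\gcd(F\cap R)$ (with $f_0:=0$ if $F\cap R=\emptyset$), and empty sets $\Lambda\subset R\setminus K$ and $\mathfrak S$. Apply procedure $\mathcal Q$ to every pair $f\ne g$ in $G$. Then repeat procedure $\mathcal P$ until $\mathfrak S=\emptyset$. Procedure $\mathcal Q$ for $f,g$: (1) if $\mathrm{lm}(f)$ and $\mathrm{lm}(g)$ are coprime, disregard $S(f,g)$ and add $\gcd(\mathrm{lc}(f),\mathrm{lc}(g))$ to $\Lambda$ if it is not constant. (2) If there is an $h\in G\setminus\{f,g\}$ with $\mathrm{lm}(h)\mid \mathrm{lcm}(\mathrm{lm}(f),\mathrm{lm}(g))$ such that rule (2) has never been applied to the triplet $\{f,g,h\}$, and neither $S(f,h)$ nor $S(g,h)$ has itself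 been disregarded, directly or through a chain of applications of (2), because of $S(f,g)$, then disregard $S(f,g)$ (because of $S(f,h)$ and $S(g,h)$) and add $\mathrm{lc}(h)/\gcd(\mathrm{lcm}(\mathrm{lc}(f),\mathrm{lc}(g)),\mathrm{lc}(h))$ to $\Lambda$ if it is not constant. (3) If neither (1) nor (2) is possible, add $S(f,g)$ to $\mathfrak S$. If both (1) and (2), or (2) with several $h$, are possible, any one of them may be carried out. Procedure $\mathcal P$: remove some $S$ from $\mathfrak S$ and make a pseudo-division of it by $G$ with multiplier $\lambda$ and remainder $r$; add $\lambda$ to $\Lambda$ if it is not constant. If $r\in R\setminus K$, replace $f_0$ by $\gcd(r,f_0)$. If $r\notin R$, add $r$ to $G$ and apply $\mathcal Q$ to all pairs $f,r$ with $f\in G\setminus\{r\}$. (A remainder $r\in K\setminus\{0\}$ halts the algorithm without output; it cannot occur if $F$ generates a proper ideal.) At the end put $G_\varepsilon:=G$, $\chi_\varepsilon:=f_0$, and add to $\Lambda$ all nonconstant $\gcd(\mathrm{lc}(f),\chi_\varepsilon)$ with $f\in G_\varepsilon$. If $F$ generates the ideal $I$, then any such $G_\varepsilon$ is called a *pseudo-basis*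 of $I$, with *pseudo-eliminant* $\chi_\varepsilon$ and *multiplier set* $\Lambda$. The *compatible part* $\mathrm{CP}(\chi_\varepsilon)$ is the product of the irreducible factors of $\chi_\varepsilon$, with their multiplicities, that are coprime to all elements of $\Lambda$. *gcd-reduction.* Let $d\in R$, $R_d=R/(d)$, and let $\sigma_d:A\to R_d[\tilde x]$ be reduction of the coefficients modulo $d$. For a finite $B\subset R_d[\tilde x]$, a term $c\,\tilde x^\alpha$ with $c\ne0$ is gcd-reducible with respect to $B$ if the set $B|_\alpha$ of those $b\in B$ for which $\mathrm{lm}(b)$ divides $\tilde x^\alpha$ is nonempty and $c$ is a multiple in $R_d$ of the gcd of the leading coefficients $\mathrm{lc}(b)$, $b\in B|_\alpha$. We say that $f\in R_d[\tilde x]$ gcd-reduces to the remainder $r$ with respect to $B$ if there are a unit $u$ of $R_d$ and $h_b\in R_d[\tilde x]$ $(b\in B)$ with $uf=\sum_{b\in B}h_b b+r$, where no term of $r$ is gcd-reducible with respect to $B$ and $\mathrm{lm}(f)=\max\{\max_b \mathrm{lm}(h_b)\mathrm{lm}(b),\mathrm{lm}(r)\}$. **Statement.** Let $I\subset A$ be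 a zero-dimensional ideal ($I\ne A$ and $\dim_K A/I<\infty$), let $G_\varepsilon$ be a pseudo-basis of $I$ with pseudo-eliminant $\chi_\varepsilon$ and multiplier set $\Lambda$, and let $d=\mathrm{CP}(\chi_\varepsilon)$, $I_d=\sigma_d(I)$ and $B_d=\sigma_d(G_\varepsilon)$. Then the ideals of $R_d[\tilde x]$ generated by the leading terms agree, $$\langle \mathrm{lt}(I_d)\rangle=\langle \mathrm{lt}(B_d)\rangle ,$$ and for every $f\in R_d[\tilde x]$ we have $f\in I_d$ if and only if $f$ gcd-reduces to the remainder $0$ with respect to $B_d$. -/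

import Mathlib

open scoped Polynomial

noncomputable section

namespace PseudoBasis

/-! ### Notation and general notions

`K[X]` is the coefficient ring `K[x₁]`, and `MvPolynomial (Fin n) K[X]` is `(K[x₁])[x̃]`, with
`n` variables `x̃`. A monomial order `m` on the monomials in `x̃` is the same thing as an
elimination ordering on the monomials in `x₁, x̃` (compare first in `x̃`, then the exponents of
`x₁`); all leading terms are taken with respect to `x̃`, with coefficients in the base ring. -/

variable {n : ℕ}

section General

variable {R : Type*} [CommRing R] (m : MonomialOrder (Fin n))

/-- The leading monomial, as an element of the ordered set of monomials with a least element `⊥`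
added; the leading monomial of `0` is `⊥`. Addition is multiplication of monomials. -/
def lm (f : MvPolynomial (Fin n) R) : WithBot m.syn :=
  m.toWithBotSyn (m.withBotDegree f)

/-- `f` is an element of the coefficient ring. -/
def IsScalar (f : MvPolynomial (Fin n) R) : Prop :=
  f ∈ Set.range (MvPolynomial.C : R → MvPolynomial (Fin n) R)

/-- `d` is a greatest common divisor of the set `s` (equal to `0` when `s` is empty). -/
def IsGCDOf (s : Set R) (d : R) : Prop :=
  (∀ a ∈ s, d ∣ a) ∧ ∀ e, (∀ a ∈ s, e ∣ a) → e ∣ d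

/-- The ideal generated by the leading terms of the elements of a set. -/
def ltIdeal (s : Set (MvPolynomial (Fin n) R)) : Ideal (MvPolynomial (Fin n) R) :=
  Ideal.span (m.leadingTerm '' s)

/-- The term `c x̃^α` is gcd-reducible with respect to `B`: some leading monomial of `B` divides
`x̃^α`, and `c` is a multiple of the gcd of the leading coefficients of all those elements of `B`
whose leading monomials divide `x̃^α`. -/
def GcdReducibleTerm (B : Finset (MvPolynomial (Fin n) R)) (α : Fin n →₀ ℕ) (c : R) : Prop :=
  (∃ b ∈ B, m.degree b ≤ α) ∧
    ∃ d, IsGCDOf {a | ∃ b ∈ B, m.degree b ≤ α ∧ a = m.leadingCoeff b} d ∧ c ∈ Ideal.span {d}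

/-- No (nonzero) term of `r` is gcd-reducible with respect to `B`. -/
def GcdReduced (B : Finset (MvPolynomial (Fin n) R)) (r : MvPolynomial (Fin n) R) : Prop :=
  ∀ α ∈ r.support, ¬ GcdReducibleTerm m B α (r.coeff α)

/-- There is a gcd-reduction of `f` with respect to `B` that has the remainder `r`, that is, an
expression `u f = ∑ h_b b + r` with a unit `u` of the coefficient ring and a gcd-reduced `r`, such
that the leading monomial of `f` is the maximum of those of `r` and of the products
`lm(h_b) lm(b)`. -/
def GcdReducesTo (B : Finset (MvPolynomial (Fin n) R)) (f r : MvPolynomial (Fin n) R) : Prop :=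
  ∃ (u : R) (h : MvPolynomial (Fin n) R → MvPolynomial (Fin n) R), IsUnit u ∧
    MvPolynomial.C u * f = ∑ b ∈ B, h b * b + r ∧ GcdReduced m B r ∧
    lm m f = (B.sup fun b => lm m (h b) + lm m b) ⊔ lm m r

end General

variable {K : Type*} [Field K] (m : MonomialOrder (Fin n))

/-- A zero-dimensional ideal: proper, with quotient of finite dimension over the field. -/
def IsZeroDimensional (I : Ideal (MvPolynomial (Fin n) K[X])) : Prop :=
  I ≠ ⊤ ∧ Module.Finite K (MvPolynomial (Fin n) K[X] ⧸ I)

/-! ### Pseudo-division and `S`-polynomials over `K[x₁]` -/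

/-- `r` is pseudo-reduced with respect to `B`: no monomial of `r` is divisible by the leading
monomial of an element of `B`. -/
def PseudoReduced (B : Finset (MvPolynomial (Fin n) K[X]))
    (r : MvPolynomial (Fin n) K[X]) : Prop :=
  ∀ α ∈ r.support, ∀ b ∈ B, ¬ m.degree b ≤ α

/-- A pseudo-division `μ f = ∑ q_b b + r` of `f` by `B` with the multiplier `μ` and the
remainder `r`. -/
def IsPseudoDivision (B : Finset (MvPolynomial (Fin n) K[X])) (f : MvPolynomial (Fin n) K[X])
    (μ : K[X]) (r : MvPolynomial (Fin n) K[X]) : Prop :=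
  μ ≠ 0 ∧ ∃ q : MvPolynomial (Fin n) K[X] → MvPolynomial (Fin n) K[X],
    MvPolynomial.C μ * f = ∑ b ∈ B, q b * b + r ∧ PseudoReduced m B r ∧
    lm m f = (B.sup fun b => lm m (q b * b)) ⊔ lm m r

open Classical in
/-- `S(f, g) = (c x̃^γ / lt f) f - (c x̃^γ / lt g) g` with `c = lcm (lc f, lc g)` and
`x̃^γ = lcm (lm f, lm g)`. -/
def sPoly (f g : MvPolynomial (Fin n) K[X]) : MvPolynomial (Fin n) K[X] :=
  MvPolynomial.monomial (m.degree f ⊔ m.degree g - m.degree f)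
      (EuclideanDomain.lcm (m.leadingCoeff f) (m.leadingCoeff g) / m.leadingCoeff f) * f -
    MvPolynomial.monomial (m.degree f ⊔ m.degree g - m.degree g)
      (EuclideanDomain.lcm (m.leadingCoeff f) (m.leadingCoeff g) / m.leadingCoeff g) * g

open Classical in
/-- The multiplier `gcd (lc f, lc g)` that belongs to a pair with coprime leading monomials. -/
def coprimeMult (f g : MvPolynomial (Fin n) K[X]) : K[X] :=
  EuclideanDomain.gcd (m.leadingCoeff f) (m.leadingCoeff g)

open Classical in
/-- The multiplier `lc h / gcd (lcm (lc f, lc g), lc h)` of the triangular identity, which writes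
`λ S(f, g)` through `S(f, h)` and `S(g, h)`. -/
def triangleMult (f g h : MvPolynomial (Fin n) K[X]) : K[X] :=
  m.leadingCoeff h / EuclideanDomain.gcd
    (EuclideanDomain.lcm (m.leadingCoeff f) (m.leadingCoeff g)) (m.leadingCoeff h)

/-! ### The algorithm -/

/-- The data that the algorithm works on. -/
structure State (n : ℕ) (K : Type*) [Field K] where
  /-- the temporary basis `G` -/
  G : Finset (MvPolynomial (Fin n) K[X])
  /-- the temporary univariate polynomial `f₀` -/
  f₀ : K[X]
  /-- the `S`-polynomials that are still to be pseudo-reduced -/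
  S : Finset (MvPolynomial (Fin n) K[X])
  /-- the pairs on which the procedure `Q` is still to be invoked -/
  pending : Finset (Sym2 (MvPolynomial (Fin n) K[X]))
  /-- the multiplier set -/
  mults : Finset K[X]
  /-- the list of the triangular identities used so far; `(f, g, h)` records that `S(f, g)` has
  been disregarded because of `S(f, h)` and `S(g, h)` -/
  triangles : List (MvPolynomial (Fin n) K[X] × MvPolynomial (Fin n) K[X] ×
    MvPolynomial (Fin n) K[X])

open Classical in
/-- Add `c` to a multiplier set unless it is a constant. -/
def addMult (s : Finset K[X]) (c : K[X]) : Finset K[X] :=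
  if c.natDegree = 0 then s else insert c s

/-- According to the triangular identities in `T`, the `S`-polynomial of the pair `a` has been
disregarded because of that of the pair `b` (and of one further pair). -/
def ReliesOn (T : List (MvPolynomial (Fin n) K[X] × MvPolynomial (Fin n) K[X] ×
    MvPolynomial (Fin n) K[X])) (a b : Sym2 (MvPolynomial (Fin n) K[X])) : Prop :=
  ∃ f g h, (f, g, h) ∈ T ∧ a = s(f, g) ∧ (b = s(f, h) ∨ b = s(g, h))

/-- The triangular identity of `S(f, g)` with respect to `h` may be applied in the state `s`:
`h ∈ G \ {f, g}`, the leading monomial of `h` divides `lcm (lm f, lm g)`, no triangular identity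
has been applied to the triplet `{f, g, h}` before, and `S(f, h)` and `S(g, h)` have not
themselves been disregarded, directly or indirectly, because of `S(f, g)`. -/
def TriangleApplies (s : State n K) (f g h : MvPolynomial (Fin n) K[X]) : Prop :=
  h ∈ s.G ∧ h ≠ f ∧ h ≠ g ∧ m.degree h ≤ m.degree f ⊔ m.degree g ∧
    (∀ a b c, (a, b, c) ∈ s.triangles →
      ({a, b, c} : Set (MvPolynomial (Fin n) K[X])) ≠ {f, g, h}) ∧
    ¬ Relation.ReflTransGen (ReliesOn s.triangles) s(f, h) s(f, g) ∧
    ¬ Relation.ReflTransGen (ReliesOn s.triangles) s(g, h) s(f, g)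

open Classical in
/-- One step of the algorithm. The first three constructors are the procedure `Q` on a pair
`f, g`; the others are the procedure `P` on an element `p` of the set of `S`-polynomials, which
takes place when `Q` has been carried out on all pairs. (If a remainder is a nonzero constant, the
ideal is not proper and the algorithm halts without a pseudo-eliminant.) -/
inductive Step : State n K → State n K → Prop
  | coprime (s : State n K) (f g : MvPolynomial (Fin n) K[X]) (hfg : s(f, g) ∈ s.pending)
      (hc : m.degree f ⊓ m.degree g = 0) :
      Step s { s with
        pending := s.pending.erase s(f, g)
        mults := addMult s.mults (coprimeMult m f g) }
  | triangle (s : State n K) (f g h : MvPolynomial (Fin n) K[X]) (hfg : s(f, g) ∈ s.pending)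
      (ht : TriangleApplies m s f g h) :
      Step s { s with
        pending := s.pending.erase s(f, g)
        mults := addMult s.mults (triangleMult m f g h)
        triangles := (f, g, h) :: s.triangles }
  | addSPoly (s : State n K) (f g : MvPolynomial (Fin n) K[X]) (hfg : s(f, g) ∈ s.pending)
      (hc : m.degree f ⊓ m.degree g ≠ 0) (ht : ∀ h, ¬ TriangleApplies m s f g h) :
      Step s { s with
        pending := s.pending.erase s(f, g)
        S := insert (sPoly m f g) s.S }
  | remZero (s : State n K) (p : MvPolynomial (Fin n) K[X]) (μ : K[X])
      (hpend : s.pending = ∅) (hp : p ∈ s.S) (hdiv : IsPseudoDivision m s.G p μ 0) :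
      Step s { s with
        S := s.S.erase p
        mults := addMult s.mults μ }
  | remScalar (s : State n K) (p : MvPolynomial (Fin n) K[X]) (μ r : K[X])
      (hpend : s.pending = ∅) (hp : p ∈ s.S)
      (hdiv : IsPseudoDivision m s.G p μ (MvPolynomial.C r)) (hr : r.natDegree ≠ 0) :
      Step s { s with
        S := s.S.erase p
        f₀ := EuclideanDomain.gcd r s.f₀
        mults := addMult s.mults μ }
  | remNew (s : State n K) (p : MvPolynomial (Fin n) K[X]) (μ : K[X])
      (r : MvPolynomial (Fin n) K[X]) (hpend : s.pending = ∅) (hp : p ∈ s.S)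
      (hdiv : IsPseudoDivision m s.G p μ r) (hr : ¬ IsScalar r) :
      Step s { s with
        G := insert r s.G
        S := s.S.erase p
        pending := s.G.image fun f => s(f, r)
        mults := addMult s.mults μ }

open Classical in
/-- The initial states for the input `F`: `G` is the set of the elements of `F` outside `K[x₁]`,
and `f₀` is a gcd of the elements of `F` in `K[x₁]`, or `0` if there are none. -/
def IsInitial (F : Finset (MvPolynomial (Fin n) K[X])) (s : State n K) : Prop :=
  s.G = F.filter (fun f => ¬ IsScalar f) ∧
    IsGCDOf {c : K[X] | MvPolynomial.C c ∈ F} s.f₀ ∧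
    s.S = ∅ ∧ s.pending = s.G.sym2.filter (fun a => ¬ a.IsDiag) ∧
    s.mults = ∅ ∧ s.triangles = []

open Classical in
/-- The final procedure `R`: add the nonconstant `gcd (lc f, χ)`, `f ∈ G`, to the multipliers. -/
def finalMults (G : Finset (MvPolynomial (Fin n) K[X])) (χ : K[X]) (Λ : Finset K[X]) :
    Finset K[X] :=
  Λ ∪ (G.image fun f => EuclideanDomain.gcd (m.leadingCoeff f) χ).filter
    (fun c => c.natDegree ≠ 0)

/-- The algorithm, with a finite set `F` of nonconstant generators of `I` as its input, can end
with the pseudo-basis `G`, the pseudo-eliminant `χ` and the multiplier set `Λ`. -/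
def IsPseudoBasis (I : Ideal (MvPolynomial (Fin n) K[X]))
    (G : Finset (MvPolynomial (Fin n) K[X])) (χ : K[X]) (Λ : Finset K[X]) : Prop :=
  ∃ F : Finset (MvPolynomial (Fin n) K[X]),
    (∀ f ∈ F, ∀ a : K, f ≠ MvPolynomial.C (Polynomial.C a)) ∧
    Ideal.span (F : Set (MvPolynomial (Fin n) K[X])) = I ∧
    ∃ s t : State n K, IsInitial F s ∧ Relation.ReflTransGen (Step m) s t ∧
      t.pending = ∅ ∧ t.S = ∅ ∧
      G = t.G ∧ χ = t.f₀ ∧ Λ = finalMults m t.G t.f₀ t.mults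

open Classical in
/-- The compatible part of `χ` with respect to the multiplier set `Λ`: the product of the
irreducible factors of `χ`, with their multiplicities, that are coprime to all elements of `Λ`. -/
def compatiblePart (χ : K[X]) (Λ : Finset K[X]) : K[X] :=
  ((UniqueFactorizationMonoid.normalizedFactors χ).filter
    (fun p => ∀ c ∈ Λ, IsCoprime p c)).prod

/-! ### Reduction modulo `d` -/

/-- The principal quotient ring `R_d = K[x₁] / (d)`. -/
abbrev ModRing (d : K[X]) : Type _ := K[X] ⧸ Ideal.span {d}

/-- The epimorphism `σ_d : (K[x₁])[x̃] → R_d[x̃]` that reduces the coefficients modulo `d`. -/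
def sigma (d : K[X]) : MvPolynomial (Fin n) K[X] →+* MvPolynomial (Fin n) (ModRing d) :=
  MvPolynomial.map (Ideal.Quotient.mk (Ideal.span {d}))

open Classical in
/-- The image `σ_d(G)` of a finite set of polynomials. -/
def modBasis (d : K[X]) (G : Finset (MvPolynomial (Fin n) K[X])) :
    Finset (MvPolynomial (Fin n) (ModRing d)) :=
  G.image (sigma d)

end PseudoBasis

end

/-! The compatible part `d` is coprime to every multiplier in `Λ`. It divides `χ` and is coprime to
each `gcd (lc f, χ)`, hence to each leading coefficient of the pseudo-basis. If `d` is a unit, `R_d`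
is trivial and so is the claim. Otherwise the multipliers and the leading coefficients become units
of `R_d`, so reduction modulo `d` keeps the leading monomials of `G`. The pseudo-eliminant becomes
`0`, and with it every remainder and every generator in `K[x₁]`, so that `B_d` generates `I_d`.

Although `R_d` may have zero divisors, Buchberger's theory works as over a field for a set with unit
leading coefficients (`mem_repSpan_degree_of_mem_span`). It remains to represent each `S`-polynomial
of `B_d` by terms below the lcm of the two leading monomials. A pseudo-division gives this once its
multiplier is inverted (`IsPseudoDivision.sPolyReduces`). Pairs disregarded by rule (1) are covered
by the product criterion, those of rule (2) by the chain criterion, since `lc h` is a unit. The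
latter calls on two other pairs; the ban on circular reliance makes this recursion well-founded
(`wellFounded_add_edges`, `Bookkeeping`).

Every element of `I_d` then has a standard representation. This is a gcd-reduction to `0`, and it
shows that the leading monomial is divisible by some `lm b` with `lc b` a unit, which gives the
equality of the leading-term ideals. -/

namespace PseudoBasis

open MvPolynomial

/-! ### Representations with bounded leading monomials -/

section RepSpan

variable {σ R : Type*} [CommRing R] (m : MonomialOrder σ)

/-- The `R`-module of the polynomials that are combinations of products `x^α b` with `b ∈ B` and
`lm (x^α b)` in `S`. -/
noncomputable def repSpan (B : Set (MvPolynomial σ R)) (S : Set m.syn) : Submodule R (MvPolynomial σ R) :=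
  Submodule.span R {p | ∃ α, ∃ b ∈ B, m.toSyn (α + m.degree b) ∈ S ∧ p = monomial α 1 * b}

variable {m} {B : Set (MvPolynomial σ R)}

theorem monomial_mul_mem_repSpan {S : Set m.syn} {b : MvPolynomial σ R} (hb : b ∈ B)
    {α : σ →₀ ℕ} (hα : m.toSyn (α + m.degree b) ∈ S) (c : R) :
    monomial α c * b ∈ repSpan m B S := by
  have h : monomial α c * b = c • (monomial α 1 * b) := by
    rw [← smul_mul_assoc, smul_monomial, smul_eq_mul, mul_one]
  rw [h]
  exact Submodule.smul_mem _ _ (Submodule.subset_span ⟨α, b, hb, hα, rfl⟩)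

theorem mul_mem_repSpan {S : Set m.syn} {b : MvPolynomial σ R} (hb : b ∈ B)
    {h : MvPolynomial σ R} (hh : ∀ α ∈ h.support, m.toSyn (α + m.degree b) ∈ S) :
    h * b ∈ repSpan m B S := by
  rw [h.as_sum, Finset.sum_mul]
  exact Submodule.sum_mem _ fun α hα => monomial_mul_mem_repSpan hb (hh α hα) _

theorem repSpan_mono {S T : Set m.syn} (h : S ⊆ T) : repSpan m B S ≤ repSpan m B T :=
  Submodule.span_mono fun _ ⟨α, b, hb, hα, hp⟩ => ⟨α, b, hb, h hα, hp⟩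

theorem monomial_mul_repSpan {S T : Set m.syn} {β : σ →₀ ℕ}
    (hST : ∀ s ∈ S, m.toSyn β + s ∈ T) {f : MvPolynomial σ R} (hf : f ∈ repSpan m B S) :
    monomial β 1 * f ∈ repSpan m B T := by
  induction hf using Submodule.span_induction with
  | mem p hp =>
    obtain ⟨α, b, hb, hα, rfl⟩ := hp
    rw [← mul_assoc, monomial_mul, one_mul]
    refine monomial_mul_mem_repSpan hb ?_ _
    rw [add_assoc, map_add]
    exact hST _ hα
  | zero => simp
  | add p q _ _ hp hq => rw [mul_add]; exact add_mem hp hq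
  | smul c p _ hp => rw [mul_smul_comm]; exact Submodule.smul_mem _ _ hp

theorem coeff_eq_zero_of_mem_repSpan_Iic {t : m.syn} {f : MvPolynomial σ R}
    (hf : f ∈ repSpan m B (Set.Iic t)) {α : σ →₀ ℕ} (hα : t < m.toSyn α) : f.coeff α = 0 := by
  induction hf using Submodule.span_induction with
  | mem p hp =>
    obtain ⟨β, b, hb, hβ, rfl⟩ := hp
    apply m.coeff_eq_zero_of_lt
    calc m.toSyn (m.degree (monomial β 1 * b))
        ≤ m.toSyn (m.degree (monomial β (1 : R))) + m.toSyn (m.degree b) :=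
          m.toSyn_degree_mul_le
      _ ≤ m.toSyn β + m.toSyn (m.degree b) := by
          gcongr; exact m.degree_monomial_le _
      _ = m.toSyn (β + m.degree b) := (map_add _ _ _).symm
      _ ≤ t := hβ
      _ < _ := hα
  | zero => simp
  | add p q _ _ hp hq => rw [coeff_add, hp, hq, add_zero]
  | smul c p _ hp => rw [coeff_smul, hp, smul_zero]

theorem coeff_eq_zero_of_mem_repSpan_Iio {α : σ →₀ ℕ} {f : MvPolynomial σ R}
    (hf : f ∈ repSpan m B (Set.Iio (m.toSyn α))) : f.coeff α = 0 := by
  induction hf using Submodule.span_induction with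
  | mem p hp =>
    obtain ⟨β, b, hb, hβ, rfl⟩ := hp
    exact coeff_eq_zero_of_mem_repSpan_Iic (B := B) (t := m.toSyn (β + m.degree b))
      (Submodule.subset_span ⟨β, b, hb, le_refl _, rfl⟩) hβ
  | zero => simp
  | add p q _ _ hp hq => rw [coeff_add, hp, hq, add_zero]
  | smul c p _ hp => rw [coeff_smul, hp, smul_zero]

/-- A polynomial in the span of `B` is in one of the modules `repSpan m B (Iic t)`. -/
theorem exists_mem_repSpan_Iic {S : Set m.syn} {f : MvPolynomial σ R}
    (hf : f ∈ repSpan m B S) : f = 0 ∨ ∃ t ∈ S, f ∈ repSpan m B (Set.Iic t) := by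
  induction hf using Submodule.span_induction with
  | mem p hp =>
    obtain ⟨β, b, hb, hβ, rfl⟩ := hp
    exact Or.inr ⟨_, hβ, Submodule.subset_span ⟨β, b, hb, le_refl _, rfl⟩⟩
  | zero => exact Or.inl rfl
  | add p q _ _ hp hq =>
    rcases hp with rfl | ⟨s, hs, hp⟩
    · simpa using hq
    rcases hq with rfl | ⟨t, ht, hq⟩
    · exact Or.inr ⟨s, hs, by simpa using hp⟩
    rcases le_total s t with h | h
    · exact Or.inr ⟨t, ht, add_mem (repSpan_mono (Set.Iic_subset_Iic.2 h) hp) hq⟩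
    · exact Or.inr ⟨s, hs, add_mem hp (repSpan_mono (Set.Iic_subset_Iic.2 h) hq)⟩
  | smul c p _ hp =>
    rcases hp with rfl | ⟨s, hs, hp⟩
    · exact Or.inl (smul_zero c)
    · exact Or.inr ⟨s, hs, Submodule.smul_mem _ _ hp⟩

theorem mem_repSpan_univ_of_mem_span {f : MvPolynomial σ R} (hf : f ∈ Ideal.span B) :
    f ∈ repSpan m B Set.univ := by
  induction hf using Submodule.span_induction with
  | mem b hb => simpa using mul_mem_repSpan (m := m) (S := Set.univ) hb (h := 1) (by simp)
  | zero => exact zero_mem _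
  | add p q _ _ hp hq => exact add_mem hp hq
  | smul c p _ hp =>
    rw [smul_eq_mul, c.as_sum, Finset.sum_mul]
    refine Submodule.sum_mem _ fun α _ => ?_
    have h : monomial α (c.coeff α) * p = c.coeff α • (monomial α 1 * p) := by
      rw [← smul_mul_assoc, smul_monomial, smul_eq_mul, mul_one]
    rw [h]
    exact Submodule.smul_mem _ _ (monomial_mul_repSpan (by simp) hp)

/-- Explicit cofactors of an element of `repSpan`. -/
theorem exists_cofactors_of_mem_repSpan {B : Finset (MvPolynomial σ R)} {S : Set m.syn} {f : MvPolynomial σ R}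
    (hf : f ∈ repSpan m (B : Set (MvPolynomial σ R)) S) :
    ∃ h : MvPolynomial σ R → MvPolynomial σ R, f = ∑ b ∈ B, h b * b ∧
      ∀ b ∈ B, ∀ α ∈ (h b).support, m.toSyn (α + m.degree b) ∈ S := by
  classical
  induction hf using Submodule.span_induction with
  | mem p hp =>
    obtain ⟨β, b, hb, hβ, rfl⟩ := hp
    refine ⟨fun c => if c = b then monomial β 1 else 0, ?_, ?_⟩
    · rw [Finset.sum_eq_single_of_mem b hb]
      · simp
      · intro c _ hc; simp [hc]
    · intro c _ α hα
      by_cases hc : c = b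
      · simp only [hc, if_true] at hα
        rw [hc]
        rw [Finset.mem_singleton.1 (support_monomial_subset hα)]
        exact hβ
      · simp [hc] at hα
  | zero => exact ⟨0, by simp, by simp⟩
  | add p q _ _ hp hq =>
    obtain ⟨h, rfl, hh⟩ := hp
    obtain ⟨k, rfl, hk⟩ := hq
    refine ⟨h + k, by simp [add_mul, Finset.sum_add_distrib], fun b hb α hα => ?_⟩
    rcases Finset.mem_union.1 (support_add hα) with h' | h'
    · exact hh b hb α h'
    · exact hk b hb α h'
  | smul c p _ hp =>
    obtain ⟨h, rfl, hh⟩ := hp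
    exact ⟨c • h, by simp [Finset.smul_sum], fun b hb α hα => hh b hb α (support_smul hα)⟩

/-! ### `S`-polynomials and Buchberger's criterion -/

/-- The `S`-polynomial of `f` and `g` has a representation in terms of `B` in which all terms are
smaller than the least common multiple of the leading monomials. -/
def SPolyReduces (m : MonomialOrder σ) (B : Set (MvPolynomial σ R)) (f g : MvPolynomial σ R) :
    Prop :=
  m.sPolynomial f g ∈ repSpan m B (Set.Iio (m.toSyn (m.degree f ⊔ m.degree g)))

theorem SPolyReduces.symm {f g : MvPolynomial σ R} (h : SPolyReduces m B f g) :
    SPolyReduces m B g f := by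
  unfold SPolyReduces at *
  rw [sup_comm, m.sPolynomial_antisymm]
  exact neg_mem h

theorem SPolyReduces.refl (f : MvPolynomial σ R) : SPolyReduces m B f f := by
  unfold SPolyReduces
  rw [m.sPolynomial_self]
  exact zero_mem _

/-- Both products have leading monomials at a common multiple of `lm f` and `lm g`; the cofactor `α
⊓ β` is what remains of it after division by the lcm. -/
theorem monomial_mul_sub_eq_monomial_mul_sPolynomial {f g : MvPolynomial σ R} {α β : σ →₀ ℕ}
    (h : α + m.degree f = β + m.degree g) :
    monomial α (m.leadingCoeff g) * f - monomial β (m.leadingCoeff f) * g =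
      monomial (α ⊓ β) 1 * m.sPolynomial f g := by
  have h' : ∀ i, α i + m.degree f i = β i + m.degree g i := fun i => DFunLike.congr_fun h i
  have hα : α = α ⊓ β + (m.degree g - m.degree f) := by
    ext i
    have := h' i
    simp only [Finsupp.add_apply, Finsupp.inf_apply, Finsupp.tsub_apply]
    omega
  have hβ : β = α ⊓ β + (m.degree f - m.degree g) := by
    ext i
    have := h' i
    simp only [Finsupp.add_apply, Finsupp.inf_apply, Finsupp.tsub_apply]
    omega
  rw [MonomialOrder.sPolynomial, mul_sub, ← mul_assoc, ← mul_assoc, monomial_mul, monomial_mul,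
    one_mul, one_mul, ← hα, ← hβ]

theorem SPolyReduces.monomial_mul_sub_mem {f g : MvPolynomial σ R} (h : SPolyReduces m B f g)
    {α β : σ →₀ ℕ} (hαβ : α + m.degree f = β + m.degree g) :
    monomial α (m.leadingCoeff g) * f - monomial β (m.leadingCoeff f) * g ∈
      repSpan m B (Set.Iio (m.toSyn (α + m.degree f))) := by
  rw [monomial_mul_sub_eq_monomial_mul_sPolynomial hαβ]
  refine monomial_mul_repSpan (fun s hs => ?_) h
  have e : α ⊓ β + (m.degree f ⊔ m.degree g) = α + m.degree f := by
    ext i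
    have : α i + m.degree f i = β i + m.degree g i := DFunLike.congr_fun hαβ i
    simp only [Finsupp.add_apply, Finsupp.inf_apply, Finsupp.sup_apply]
    omega
  rw [Set.mem_Iio, ← e, map_add]
  exact add_lt_add_right hs _

/-- Buchberger's chain criterion. -/
theorem SPolyReduces.of_triangle {f g h : MvPolynomial σ R} (hu : IsUnit (m.leadingCoeff h))
    (hle : m.degree h ≤ m.degree f ⊔ m.degree g) (hf : SPolyReduces m B f h)
    (hg : SPolyReduces m B g h) : SPolyReduces m B f g := by
  set γ := m.degree f ⊔ m.degree g with hγ
  have ef : γ - m.degree f + m.degree f = γ := tsub_add_cancel_of_le le_sup_left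
  have eg : γ - m.degree g + m.degree g = γ := tsub_add_cancel_of_le le_sup_right
  have eh : γ - m.degree h + m.degree h = γ := tsub_add_cancel_of_le hle
  have h1 := hf.monomial_mul_sub_mem (ef.trans eh.symm)
  have h2 := hg.monomial_mul_sub_mem (eg.trans eh.symm)
  rw [ef] at h1
  rw [eg] at h2
  -- With these weights the two multiples of `h` cancel, and `lc h` times the `S`-polynomial of `f`
  -- and `g` is left.
  have h3 := sub_mem (Submodule.smul_mem _ (m.leadingCoeff g) h1)
    (Submodule.smul_mem _ (m.leadingCoeff f) h2)
  have e : m.leadingCoeff g • (monomial (γ - m.degree f) (m.leadingCoeff h) * f -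
        monomial (γ - m.degree h) (m.leadingCoeff f) * h) -
      m.leadingCoeff f • (monomial (γ - m.degree g) (m.leadingCoeff h) * g -
        monomial (γ - m.degree h) (m.leadingCoeff g) * h) =
      m.leadingCoeff h • m.sPolynomial f g := by
    rw [m.sPolynomial_def, ← hγ]
    simp only [smul_sub, ← smul_mul_assoc, smul_monomial, smul_eq_mul]
    rw [mul_comm (m.leadingCoeff g) (m.leadingCoeff f),
      mul_comm (m.leadingCoeff g) (m.leadingCoeff h),
      mul_comm (m.leadingCoeff f) (m.leadingCoeff h)]
    abel
  rw [e] at h3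
  obtain ⟨u, hu⟩ := hu
  have h4 := Submodule.smul_mem _ (↑u⁻¹ : R) h3
  rwa [smul_smul, ← hu, Units.inv_mul, one_smul] at h4

theorem toSyn_lt_degree_of_mem_support_sub_leadingTerm {f : MvPolynomial σ R} {α : σ →₀ ℕ}
    (hα : α ∈ (f - m.leadingTerm f).support) : m.toSyn α < m.toSyn (m.degree f) := by
  classical
  rw [mem_support_iff, MonomialOrder.leadingTerm, coeff_sub, coeff_monomial] at hα
  by_cases h : m.degree f = α
  · subst h
    simp [MonomialOrder.leadingCoeff] at hα
  · rw [if_neg h, sub_zero] at hα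
    exact lt_of_le_of_ne (m.le_degree (mem_support_iff.2 hα))
      fun e => h (m.toSyn.injective e).symm

/-- Buchberger's product criterion. -/
theorem SPolyReduces.of_coprime {f g : MvPolynomial σ R} (hf : f ∈ B) (hg : g ∈ B)
    (h : m.degree f ⊓ m.degree g = 0) : SPolyReduces m B f g := by
  have h' : ∀ i, min (m.degree f i) (m.degree g i) = 0 := fun i => DFunLike.congr_fun h i
  have e1 : m.degree g - m.degree f = m.degree g := by
    ext i; have := h' i; simp only [Finsupp.tsub_apply]; omega
  have e2 : m.degree f - m.degree g = m.degree f := by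
    ext i; have := h' i; simp only [Finsupp.tsub_apply]; omega
  have e3 : m.degree f ⊔ m.degree g = m.degree f + m.degree g := by
    ext i; have := h' i; simp only [Finsupp.add_apply, Finsupp.sup_apply]; omega
  -- By coprimality the `S`-polynomial is `lt g * f - lt f * g`; inserting `f * g` with both signs
  -- replaces the leading terms by the tails.
  have e : m.sPolynomial f g = (f - m.leadingTerm f) * g - (g - m.leadingTerm g) * f := by
    rw [MonomialOrder.sPolynomial, e1, e2]
    simp only [MonomialOrder.leadingTerm]
    ring
  unfold SPolyReduces
  rw [e, e3]
  refine sub_mem (mul_mem_repSpan hg fun α hα => ?_) (mul_mem_repSpan hf fun α hα => ?_)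
  · rw [Set.mem_Iio, map_add, map_add]
    exact add_lt_add_left (toSyn_lt_degree_of_mem_support_sub_leadingTerm hα) _
  · rw [Set.mem_Iio, map_add, map_add, add_comm (m.toSyn (m.degree f))]
    exact add_lt_add_left (toSyn_lt_degree_of_mem_support_sub_leadingTerm hα) _

/-- If the coefficient at the upper bound of a representation vanishes, then there is a
representation by smaller terms. -/
theorem mem_repSpan_Iio_of_coeff_eq_zero (hu : ∀ b ∈ B, IsUnit (m.leadingCoeff b))
    (hS : ∀ b ∈ B, ∀ c ∈ B, SPolyReduces m B b c) {τ : σ →₀ ℕ} {f : MvPolynomial σ R}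
    (hf : f ∈ repSpan m B (Set.Iic (m.toSyn τ))) (h0 : f.coeff τ = 0) :
    f ∈ repSpan m B (Set.Iio (m.toSyn τ)) := by
  by_cases hc : ∃ c ∈ B, ∃ β, β + m.degree c = τ
  · obtain ⟨c, hc, β, hβ⟩ := hc
    -- Modulo smaller terms, each generator at the level `τ` is a scalar multiple of the single
    -- product `x^β c`. The coefficient of `f` at `τ` is then `a * lc c`, so its vanishing forces `a
    -- = 0`.
    have key : ∃ a : R, f - a • (monomial β 1 * c) ∈ repSpan m B (Set.Iio (m.toSyn τ)) := by
      clear h0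
      induction hf using Submodule.span_induction with
      | mem p hp =>
        obtain ⟨α, b, hb, hα, rfl⟩ := hp
        rcases eq_or_lt_of_le (show m.toSyn (α + m.degree b) ≤ m.toSyn τ from hα) with h | h
        · have h := m.toSyn.injective h
          obtain ⟨u, huc⟩ := hu c hc
          have h1 := (hS b hb c hc).monomial_mul_sub_mem (h.trans hβ.symm)
          rw [h] at h1
          refine ⟨↑u⁻¹ * m.leadingCoeff b, ?_⟩
          have h2 := Submodule.smul_mem _ (↑u⁻¹ : R) h1
          have e : (↑u⁻¹ : R) • (monomial α (m.leadingCoeff c) * b -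
              monomial β (m.leadingCoeff b) * c) =
              monomial α 1 * b - (↑u⁻¹ * m.leadingCoeff b) • (monomial β 1 * c) := by
            simp only [smul_sub, ← smul_mul_assoc, smul_monomial, smul_eq_mul, ← huc,
              Units.inv_mul, mul_one]
          rwa [e] at h2
        · exact ⟨0, by simpa using monomial_mul_mem_repSpan hb h 1⟩
      | zero => exact ⟨0, by simp⟩
      | add p q _ _ hp hq =>
        obtain ⟨a, ha⟩ := hp
        obtain ⟨a', ha'⟩ := hq
        refine ⟨a + a', ?_⟩
        have e : p + q - (a + a') • (monomial β 1 * c) =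
            p - a • (monomial β 1 * c) + (q - a' • (monomial β 1 * c)) := by
          rw [add_smul]; abel
        rw [e]
        exact add_mem ha ha'
      | smul r p _ hp =>
        obtain ⟨a, ha⟩ := hp
        refine ⟨r * a, ?_⟩
        rw [mul_smul, ← smul_sub]
        exact Submodule.smul_mem _ _ ha
    obtain ⟨a, ha⟩ := key
    have h1 := coeff_eq_zero_of_mem_repSpan_Iio ha
    rw [coeff_sub, h0, coeff_smul, ← hβ, coeff_monomial_mul, zero_sub, neg_eq_zero, one_mul,
      smul_eq_mul] at h1
    have h2 : a = 0 := (hu c hc).mul_left_eq_zero.1 h1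
    simpa [h2] using ha
  -- No leading monomial divides `x^τ`, so no generator attains the bound.
  · refine Submodule.span_mono ?_ hf
    rintro p ⟨α, b, hb, hα, rfl⟩
    refine ⟨α, b, hb, lt_of_le_of_ne hα fun h => hc ⟨b, hb, α, m.toSyn.injective h⟩, rfl⟩

/-- Buchberger's criterion: if all leading coefficients are units and all `S`-polynomials reduce,
then every element of the ideal has a standard representation. -/
theorem mem_repSpan_degree_of_mem_span (hu : ∀ b ∈ B, IsUnit (m.leadingCoeff b))
    (hS : ∀ b ∈ B, ∀ c ∈ B, SPolyReduces m B b c) {f : MvPolynomial σ R}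
    (hf : f ∈ Ideal.span B) : f ∈ repSpan m B (Set.Iic (m.toSyn (m.degree f))) := by
  rcases exists_mem_repSpan_Iic (mem_repSpan_univ_of_mem_span (m := m) hf) with rfl | ⟨t, -, ht⟩
  · exact zero_mem _
  -- The bound of the representation is lowered until it reaches the degree of `f`; this ends
  -- because a monomial order is a well-order.
  induction t using WellFoundedLT.induction with
  | ind t ih =>
    by_cases hle : t ≤ m.toSyn (m.degree f)
    · exact repSpan_mono (Set.Iic_subset_Iic.2 hle) ht
    obtain ⟨τ, rfl⟩ := m.toSyn.surjective t
    have h1 := mem_repSpan_Iio_of_coeff_eq_zero hu hS ht (m.coeff_eq_zero_of_lt (not_le.1 hle))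
    rcases exists_mem_repSpan_Iic h1 with rfl | ⟨s, hs, h2⟩
    · exact zero_mem _
    · exact ih s hs h2

/-- If no leading monomial divided that of `f`, all generators would stay strictly below it, and the
leading coefficient of `f` would vanish. -/
theorem exists_degree_le_of_mem_repSpan {f : MvPolynomial σ R} (hf0 : f ≠ 0)
    (hf : f ∈ repSpan m B (Set.Iic (m.toSyn (m.degree f)))) : ∃ b ∈ B, m.degree b ≤ m.degree f := by
  by_contra! hc
  refine (m.coeff_degree_ne_zero_iff (f := f)).2 hf0 (coeff_eq_zero_of_mem_repSpan_Iio (m := m) (B := B) ?_)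
  refine Submodule.span_mono ?_ hf
  rintro p ⟨α, b, hb, hα, rfl⟩
  refine ⟨α, b, hb, lt_of_le_of_ne hα fun h => hc b hb ?_, rfl⟩
  rw [← m.toSyn.injective h]
  exact le_add_self

end RepSpan

end PseudoBasis

namespace PseudoBasis

open MvPolynomial

/-! ### Leading monomials and gcd-reduction to zero -/

section LeadingMonomials

variable {n : ℕ} {R : Type*} [CommRing R] (m : MonomialOrder (Fin n))

theorem lm_zero : lm m (0 : MvPolynomial (Fin n) R) = ⊥ := by
  simp [lm]

theorem lm_of_ne_zero {f : MvPolynomial (Fin n) R} (hf : f ≠ 0) :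
    lm m f = (m.toSyn (m.degree f) : WithBot m.syn) := by
  rw [lm, (m.withBotDegree_eq_coe_degree_iff f).2 hf, m.toWithBotSyn_apply_coe]

theorem lm_lt_coe_iff {f : MvPolynomial (Fin n) R} {t : m.syn} :
    lm m f < (t : WithBot m.syn) ↔ ∀ α ∈ f.support, m.toSyn α < t := by
  by_cases hf : f = 0
  · simp [hf, lm_zero]
  · rw [lm_of_ne_zero m hf, WithBot.coe_lt_coe]
    exact ⟨fun h α hα => (m.le_degree hα).trans_lt h, fun h => h _ (m.degree_mem_support hf)⟩

theorem gcdReducesTo_zero_zero (B : Finset (MvPolynomial (Fin n) R)) : GcdReducesTo m B 0 0 := by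
  refine ⟨1, 0, isUnit_one, by simp, fun α hα => by simp at hα, ?_⟩
  have : (B.sup fun b => lm m ((0 : MvPolynomial (Fin n) R → MvPolynomial (Fin n) R) b) +
      lm m b) = ⊥ := by
    rw [Finset.sup_eq_bot_iff]
    intro b _
    rw [Pi.zero_apply, lm_zero, WithBot.bot_add]
  rw [this, lm_zero, sup_idem]

/-- The cofactors of a standard representation serve with the unit `1`. Their products are bounded
by `lm f`, and since they sum to `f` the bound is attained. -/
theorem gcdReducesTo_zero_of_mem_repSpan {B : Finset (MvPolynomial (Fin n) R)}
    {f : MvPolynomial (Fin n) R}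
    (hf : f ∈ repSpan m (B : Set (MvPolynomial (Fin n) R)) (Set.Iic (m.toSyn (m.degree f)))) :
    GcdReducesTo m B f 0 := by
  by_cases hf0 : f = 0
  · rw [hf0]
    exact gcdReducesTo_zero_zero m B
  obtain ⟨h, hsum, hle⟩ := exists_cofactors_of_mem_repSpan hf
  refine ⟨1, h, isUnit_one, by rw [C_1, one_mul, add_zero]; exact hsum,
    fun α hα => by simp at hα, ?_⟩
  rw [lm_zero, sup_bot_eq]
  apply le_antisymm
  · conv_lhs => rw [hsum]
    exact (m.withBotDegree_sum_le).trans
      (Finset.sup_mono_fun fun b _ => m.toWithBotSyn_withBotDegree_mul_le _ _)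
  · refine Finset.sup_le fun b hb => ?_
    by_cases h0 : h b = 0
    · rw [h0, lm_zero, WithBot.bot_add]; exact bot_le
    by_cases b0 : b = 0
    · rw [b0, lm_zero, WithBot.add_bot]; exact bot_le
    rw [lm_of_ne_zero m h0, lm_of_ne_zero m b0, lm_of_ne_zero m hf0, ← WithBot.coe_add,
      WithBot.coe_le_coe, ← map_add]
    exact hle b hb _ (m.degree_mem_support h0)

theorem leadingTerm_mem_ltIdeal {B : Set (MvPolynomial (Fin n) R)} {f b : MvPolynomial (Fin n) R}
    (hb : b ∈ B) (hu : IsUnit (m.leadingCoeff b)) (hle : m.degree b ≤ m.degree f) :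
    m.leadingTerm f ∈ ltIdeal m B := by
  obtain ⟨u, hu⟩ := hu
  have e : m.leadingTerm f =
      monomial (m.degree f - m.degree b) (m.leadingCoeff f * ↑u⁻¹) * m.leadingTerm b := by
    rw [MonomialOrder.leadingTerm, MonomialOrder.leadingTerm, monomial_mul,
      tsub_add_cancel_of_le hle, ← hu, mul_assoc, Units.inv_mul, mul_one]
  rw [e]
  exact Ideal.mul_mem_left _ _ (Ideal.subset_span ⟨b, hb, rfl⟩)

end LeadingMonomials

/-! ### Leading data under a map of the coefficients -/

section CoefficientMap

variable {σ R S : Type*} [CommRing R] [CommRing S] {m : MonomialOrder σ} {φ : R →+* S}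

theorem degree_map_of_ne_zero {f : MvPolynomial σ R} (h : φ (m.leadingCoeff f) ≠ 0) :
    m.degree (map φ f) = m.degree f := by
  apply m.toSyn.injective
  apply le_antisymm
  · rw [m.degree_le_iff]
    exact fun α hα => m.le_degree (support_map_subset φ f hα)
  · apply m.le_degree
    rw [mem_support_iff, coeff_map]
    exact h

theorem leadingCoeff_map_of_ne_zero {f : MvPolynomial σ R} (h : φ (m.leadingCoeff f) ≠ 0) :
    m.leadingCoeff (map φ f) = φ (m.leadingCoeff f) := by
  rw [MonomialOrder.leadingCoeff, degree_map_of_ne_zero h, coeff_map, MonomialOrder.leadingCoeff]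

theorem map_sPolynomial {f g : MvPolynomial σ R} (hf : φ (m.leadingCoeff f) ≠ 0)
    (hg : φ (m.leadingCoeff g) ≠ 0) :
    map φ (m.sPolynomial f g) = m.sPolynomial (map φ f) (map φ g) := by
  simp only [MonomialOrder.sPolynomial, map_sub, map_mul, map_monomial,
    degree_map_of_ne_zero hf, degree_map_of_ne_zero hg, leadingCoeff_map_of_ne_zero hf,
    leadingCoeff_map_of_ne_zero hg]

end CoefficientMap

/-! ### Pseudo-division of `S`-polynomials -/

section PseudoDivision

variable {n : ℕ} {K : Type*} [Field K] {m : MonomialOrder (Fin n)}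

-- As `gcd * lcm` is the product, the `S`-polynomial with lcm coefficients and the cross-multiplied
-- one differ by the factor `gcd (lc f, lc g)`. Buchberger's criterion is proved for the latter.
open Classical in
theorem C_gcd_mul_sPoly {f g : MvPolynomial (Fin n) (Polynomial K)}
    (hf : f ≠ 0) (hg : g ≠ 0) :
    C (EuclideanDomain.gcd (m.leadingCoeff f) (m.leadingCoeff g)) * sPoly m f g =
      m.sPolynomial f g := by
  have key : ∀ a b : Polynomial K, a ≠ 0 → b ≠ 0 →
      EuclideanDomain.gcd a b * (EuclideanDomain.lcm a b / a) = b ∧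
      EuclideanDomain.gcd a b * (EuclideanDomain.lcm a b / b) = a := by
    intro a b ha hb
    constructor
    · apply mul_left_cancel₀ ha
      rw [mul_left_comm, EuclideanDomain.mul_div_cancel' ha (EuclideanDomain.dvd_lcm_left a b),
        EuclideanDomain.gcd_mul_lcm]
    · apply mul_left_cancel₀ hb
      rw [mul_left_comm, EuclideanDomain.mul_div_cancel' hb (EuclideanDomain.dvd_lcm_right a b),
        EuclideanDomain.gcd_mul_lcm, mul_comm]
  obtain ⟨h1, h2⟩ := key _ _ (m.leadingCoeff_ne_zero_iff.2 hf) (m.leadingCoeff_ne_zero_iff.2 hg)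
  rw [sPoly, m.sPolynomial_def, mul_sub, ← mul_assoc, ← mul_assoc, C_mul_monomial,
    C_mul_monomial, h1, h2]

theorem lm_sPoly_lt {f g : MvPolynomial (Fin n) (Polynomial K)} (hf : f ≠ 0) (hg : g ≠ 0) :
    lm m (sPoly m f g) < (m.toSyn (m.degree f ⊔ m.degree g) : WithBot m.syn) := by
  classical
  rw [lm_lt_coe_iff]
  intro α hα
  have h : α ∈ (m.sPolynomial f g).support := by
    rw [← C_gcd_mul_sPoly hf hg, mem_support_iff, coeff_C_mul]
    refine mul_ne_zero (fun h => ?_) (mem_support_iff.1 hα)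
    exact m.leadingCoeff_ne_zero_iff.2 hf (EuclideanDomain.gcd_eq_zero_iff.1 h).1
  refine (m.le_degree h).trans_lt (m.degree_sPolynomial_lt_sup_degree fun h0 => ?_)
  simp [h0] at h

theorem sPoly_mem {I : Ideal (MvPolynomial (Fin n) (Polynomial K))}
    {f g : MvPolynomial (Fin n) (Polynomial K)} (hf : f ∈ I) (hg : g ∈ I) : sPoly m f g ∈ I :=
  sub_mem (I.mul_mem_left _ hf) (I.mul_mem_left _ hg)

theorem IsPseudoDivision.remainder_mem {I : Ideal (MvPolynomial (Fin n) (Polynomial K))}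
    {G : Finset (MvPolynomial (Fin n) (Polynomial K))} {p r : MvPolynomial (Fin n) (Polynomial K)}
    {μ : Polynomial K} (h : IsPseudoDivision m G p μ r) (hG : ∀ g ∈ G, g ∈ I) (hp : p ∈ I) :
    r ∈ I := by
  obtain ⟨-, q, hq, -⟩ := h
  rw [eq_sub_of_add_eq' hq.symm]
  exact sub_mem (I.mul_mem_left _ hp) (Ideal.sum_mem _ fun b hb => I.mul_mem_left _ (hG b hb))

/-- A pseudo-division of an `S`-polynomial yields a representation of the image of the
`S`-polynomial under a map of the coefficients by which the multiplier and the leading coefficients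
become units, if the remainder is in the basis or is mapped to zero. -/
theorem IsPseudoDivision.sPolyReduces {R : Type*} [CommRing R] [Nontrivial R]
    {φ : Polynomial K →+* R} {G H : Finset (MvPolynomial (Fin n) (Polynomial K))}
    (hH : ∀ f ∈ H, IsUnit (φ (m.leadingCoeff f))) (hGH : G ⊆ H)
    {f g r : MvPolynomial (Fin n) (Polynomial K)} (hf : f ∈ H) (hg : g ∈ H) {μ : Polynomial K}
    (h : IsPseudoDivision m G (sPoly m f g) μ r) (hμ : IsUnit (φ μ)) (hr : map φ r = 0 ∨ r ∈ H) :
    SPolyReduces m (map φ '' (H : Set (MvPolynomial (Fin n) (Polynomial K))))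
      (map φ f) (map φ g) := by
  classical
  have hne : ∀ f ∈ H, φ (m.leadingCoeff f) ≠ 0 := fun f hf => (hH f hf).ne_zero
  have hne' : ∀ f ∈ H, f ≠ 0 := by
    rintro f hf rfl
    exact hne 0 hf (by simp)
  obtain ⟨-, q, hq, -, hlm⟩ := h
  have hlt := lm_sPoly_lt (m := m) (hne' f hf) (hne' g hg)
  -- The maximality condition of the pseudo-division passes the strict bound on to each `q b * b`
  -- and to `r`.
  rw [hlm, sup_lt_iff, Finset.sup_lt_iff (WithBot.bot_lt_coe _)] at hlt
  set γ := m.degree f ⊔ m.degree g with hγ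
  set B := map φ '' (H : Set (MvPolynomial (Fin n) (Polynomial K))) with hB
  have hmem : C (φ μ) * map φ (sPoly m f g) ∈ repSpan m B (Set.Iio (m.toSyn γ)) := by
    rw [← map_C, ← map_mul, hq, map_add, map_sum]
    refine add_mem (Submodule.sum_mem _ fun b hb => ?_) ?_
    · rw [map_mul]
      refine mul_mem_repSpan (Set.mem_image_of_mem _ (hGH hb)) fun α hα => ?_
      -- Degrees add over the domain `K[X]`, so the bound is obtained there; the map can only shrink
      -- the support of `q b`, and it keeps the degree of `b`.
      have hα := support_map_subset φ _ hα
      have hq0 : q b ≠ 0 := by rintro h0; simp [h0] at hα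
      have hb0 := hne' b (hGH hb)
      have h1 := hlt.1 b hb
      rw [lm_of_ne_zero m (mul_ne_zero hq0 hb0), WithBot.coe_lt_coe, m.degree_mul hq0 hb0] at h1
      rw [degree_map_of_ne_zero (hne b (hGH hb)), Set.mem_Iio]
      refine lt_of_le_of_lt ?_ h1
      rw [map_add, map_add]
      gcongr
      exact m.le_degree hα
    · rcases hr with hr | hr
      · rw [hr]; exact zero_mem _
      · have h1 := hlt.2
        rw [lm_of_ne_zero m (hne' r hr), WithBot.coe_lt_coe] at h1
        rw [← one_mul (map φ r)]
        refine mul_mem_repSpan (Set.mem_image_of_mem _ hr) fun α hα => ?_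
        have : α = 0 := Finset.mem_singleton.1 (support_monomial_subset hα)
        rw [this, zero_add, degree_map_of_ne_zero (hne r hr)]
        exact h1
  have hmem' : map φ (sPoly m f g) ∈ repSpan m B (Set.Iio (m.toSyn γ)) := by
    obtain ⟨u, hu⟩ := hμ
    have h1 := Submodule.smul_mem _ (↑u⁻¹ : R) hmem
    rwa [← hu, ← smul_eq_C_mul, smul_smul, Units.inv_mul, one_smul] at h1
  unfold SPolyReduces
  rw [← map_sPolynomial (hne f hf) (hne g hg), degree_map_of_ne_zero (hne f hf),
    degree_map_of_ne_zero (hne g hg), ← hγ, ← C_gcd_mul_sPoly (hne' f hf) (hne' g hg), map_mul,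
    map_C, ← smul_eq_C_mul]
  exact Submodule.smul_mem _ _ hmem'

end PseudoDivision

end PseudoBasis

/-! ### The bookkeeping of the algorithm -/

namespace PseudoBasis

open MvPolynomial

/-- All new edges start at `x`. A vertex that does not reach `x` never meets them, and every
successor of `x`, old or new, is such a vertex. So `x` is accessible, and then so are the vertices
that lead to it. -/
theorem wellFounded_add_edges {V : Type*} {r r' : V → V → Prop} (hr : WellFounded (flip r))
    (x : V) (Y : Set V) (h : ∀ a b, r' a b → r a b ∨ (a = x ∧ b ∈ Y))
    (hY : ∀ y ∈ Y, ¬ Relation.ReflTransGen r y x) : WellFounded (flip r') := by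
  have acyclic : ∀ w, r x w → ¬ Relation.ReflTransGen r w x := by
    intro w hw hwx
    have h1 : Relation.TransGen (flip r) x x := by
      rw [Relation.transGen_swap]
      exact Relation.TransGen.head' hw hwx
    exact hr.transGen.irrefl.irrefl x h1
  have away : ∀ z, ¬ Relation.ReflTransGen r z x → Acc (flip r') z := by
    intro z
    induction z using hr.induction with
    | _ z ih =>
      intro hz
      refine Acc.intro z fun w hw => ?_
      rcases h z w hw with h1 | ⟨rfl, -⟩
      · exact ih w h1 fun h2 => hz (Relation.ReflTransGen.head h1 h2)
      · exact absurd Relation.ReflTransGen.refl hz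
  have hx : Acc (flip r') x := by
    refine Acc.intro x fun w hw => ?_
    rcases h x w hw with h1 | ⟨-, h1⟩
    · exact away w (acyclic w h1)
    · exact away w (hY w h1)
  refine ⟨fun z => ?_⟩
  induction z using hr.induction with
  | _ z ih =>
    refine Acc.intro z fun w hw => ?_
    rcases h z w hw with h1 | ⟨rfl, h1⟩
    · exact ih w h1
    · exact hx.inv hw

section Algorithm

variable {n : ℕ} {K : Type*} [Field K] {m : MonomialOrder (Fin n)}

theorem subset_addMult (s : Finset (Polynomial K)) (c : Polynomial K) : s ⊆ addMult s c := by
  classical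
  unfold addMult
  split_ifs
  · exact subset_rfl
  · exact Finset.subset_insert _ _

/-- The constants that `addMult` leaves out are already units of `K[X]` if they are nonzero. -/
theorem isUnit_map_of_addMult_subset {R : Type*} [CommRing R] {φ : Polynomial K →+* R}
    {s L : Finset (Polynomial K)} {c : Polynomial K} (hc : c ≠ 0)
    (hL : ∀ a ∈ L, IsUnit (φ a)) (h : addMult s c ⊆ L) : IsUnit (φ c) := by
  classical
  by_cases h0 : c.natDegree = 0
  · refine IsUnit.map φ (Polynomial.isUnit_iff_degree_eq_zero.2 ?_)
    rw [Polynomial.degree_eq_natDegree hc, h0, Nat.cast_zero]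
  · refine hL c (h ?_)
    rw [addMult, if_neg h0]
    exact Finset.mem_insert_self _ _

theorem Step.mono {s t : State n K} (h : Step m s t) :
    s.G ⊆ t.G ∧ t.f₀ ∣ s.f₀ ∧ s.mults ⊆ t.mults := by
  classical
  cases h with
  | coprime => exact ⟨subset_rfl, dvd_rfl, subset_addMult _ _⟩
  | triangle => exact ⟨subset_rfl, dvd_rfl, subset_addMult _ _⟩
  | addSPoly => exact ⟨subset_rfl, dvd_rfl, subset_rfl⟩
  | remZero => exact ⟨subset_rfl, dvd_rfl, subset_addMult _ _⟩
  | remScalar => exact ⟨subset_rfl, EuclideanDomain.gcd_dvd_right _ _, subset_addMult _ _⟩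
  | remNew => exact ⟨Finset.subset_insert _ _, dvd_rfl, subset_addMult _ _⟩

theorem reflTransGen_step_mono {s t : State n K} (h : Relation.ReflTransGen (Step m) s t) :
    s.G ⊆ t.G ∧ t.f₀ ∣ s.f₀ ∧ s.mults ⊆ t.mults := by
  induction h with
  | refl => exact ⟨subset_rfl, dvd_rfl, subset_rfl⟩
  | tail _ h ih =>
    exact ⟨ih.1.trans h.mono.1, h.mono.2.1.trans ih.2.1, ih.2.2.trans h.mono.2.2⟩

/-- All polynomials that occur are in the ideal. -/
theorem Step.mem_ideal {I : Ideal (MvPolynomial (Fin n) (Polynomial K))} {s t : State n K}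
    (h : Step m s t) (hG : ∀ f ∈ s.G, f ∈ I) (hS : ∀ f ∈ s.S, f ∈ I)
    (hp : ∀ f g, s(f, g) ∈ s.pending → f ∈ s.G ∧ g ∈ s.G) :
    (∀ f ∈ t.G, f ∈ I) ∧ (∀ f ∈ t.S, f ∈ I) ∧
      ∀ f g, s(f, g) ∈ t.pending → f ∈ t.G ∧ g ∈ t.G := by
  classical
  cases h with
  | coprime f g hfg => exact ⟨hG, hS, fun a b hab => hp a b (Finset.mem_of_mem_erase hab)⟩
  | triangle f g h hfg => exact ⟨hG, hS, fun a b hab => hp a b (Finset.mem_of_mem_erase hab)⟩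
  | addSPoly f g hfg =>
    refine ⟨hG, fun p hpS => ?_, fun a b hab => hp a b (Finset.mem_of_mem_erase hab)⟩
    rcases Finset.mem_insert.1 hpS with rfl | hpS
    · exact sPoly_mem (hG _ (hp f g hfg).1) (hG _ (hp f g hfg).2)
    · exact hS p hpS
  | remZero => exact ⟨hG, fun p hpS => hS p (Finset.mem_of_mem_erase hpS), hp⟩
  | remScalar => exact ⟨hG, fun p hpS => hS p (Finset.mem_of_mem_erase hpS), hp⟩
  | remNew p μ r hpend hpS hdiv =>
    refine ⟨fun f hf => ?_, fun p hpS => hS p (Finset.mem_of_mem_erase hpS), fun a b hab => ?_⟩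
    · rcases Finset.mem_insert.1 hf with rfl | hf
      · exact hdiv.remainder_mem hG (hS p hpS)
      · exact hG f hf
    · obtain ⟨f, hf, he⟩ := Finset.mem_image.1 hab
      rcases Sym2.eq_iff.1 he with ⟨rfl, rfl⟩ | ⟨rfl, rfl⟩
      · exact ⟨Finset.mem_insert_of_mem hf, Finset.mem_insert_self _ _⟩
      · exact ⟨Finset.mem_insert_self _ _, Finset.mem_insert_of_mem hf⟩

/-- The bookkeeping of the `S`-polynomials in a state: `Good f g` means that the `S`-polynomial of
`f` and `g` has been dealt with independently of other pairs. -/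
structure Bookkeeping (m : MonomialOrder (Fin n))
    (Good : MvPolynomial (Fin n) (Polynomial K) → MvPolynomial (Fin n) (Polynomial K) → Prop)
    (s : State n K) : Prop where
  cover : ∀ f ∈ s.G, ∀ g ∈ s.G, f ≠ g → s(f, g) ∈ s.pending ∨
    (∃ a b c, (a, b, c) ∈ s.triangles ∧ s(f, g) = s(a, b)) ∨
    (∃ a b, s(f, g) = s(a, b) ∧ sPoly m a b ∈ s.S) ∨ Good f g
  triangle_le : ∀ a b c, (a, b, c) ∈ s.triangles →
    c ∈ s.G ∧ m.degree c ≤ m.degree a ⊔ m.degree b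
  wf : WellFounded (flip (ReliesOn s.triangles))

theorem Bookkeeping.of_isInitial
    (Good : MvPolynomial (Fin n) (Polynomial K) → MvPolynomial (Fin n) (Polynomial K) → Prop)
    {F : Finset (MvPolynomial (Fin n) (Polynomial K))} {s : State n K} (h : IsInitial F s) :
    Bookkeeping m Good s := by
  classical
  obtain ⟨-, -, -, hpend, -, htri⟩ := h
  refine ⟨fun f hf g hg hfg => Or.inl ?_, fun a b c h => ?_, ⟨fun z => Acc.intro z fun w hw => ?_⟩⟩
  · rw [hpend, Finset.mem_filter, Finset.mk_mem_sym2_iff, Sym2.mk_isDiag_iff]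
    exact ⟨⟨hf, hg⟩, hfg⟩
  · simp [htri] at h
  · obtain ⟨f, g, h, hmem, -⟩ := hw
    simp [htri] at hmem

/-- A pair leaves the pending set by becoming good, by a triangle, or by queueing its
`S`-polynomial. Since `S` stores polynomials and not pairs, dividing `p` must settle all pairs with
this `S`-polynomial at once. Well-foundedness survives a triangle because reliance on the pair
itself is forbidden. -/
theorem Bookkeeping.step
    {Good : MvPolynomial (Fin n) (Polynomial K) → MvPolynomial (Fin n) (Polynomial K) → Prop}
    (symm : ∀ f g, Good f g → Good g f) {s t : State n K} (hb : Bookkeeping m Good s)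
    (h : Step m s t)
    (coprime : ∀ f ∈ t.G, ∀ g ∈ t.G, m.degree f ⊓ m.degree g = 0 → Good f g)
    (reduced : ∀ p μ r, IsPseudoDivision m s.G p μ r → addMult s.mults μ ⊆ t.mults →
      (r ∈ t.G ∨ ∃ c, r = C c ∧ t.f₀ ∣ c) → ∀ f ∈ t.G, ∀ g ∈ t.G, sPoly m f g = p → Good f g) :
    Bookkeeping m Good t := by
  classical
  have good_of_eq : ∀ {f g a b}, s(f, g) = s(a, b) → Good a b → Good f g := by
    intro f g a b he hab
    rcases Sym2.eq_iff.1 he with ⟨rfl, rfl⟩ | ⟨rfl, rfl⟩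
    · exact hab
    · exact symm _ _ hab
  have mem_of_eq : ∀ {G : Finset (MvPolynomial (Fin n) (Polynomial K))} {f g a b},
      s(f, g) = s(a, b) → f ∈ G → g ∈ G → a ∈ G ∧ b ∈ G := by
    intro G f g a b he hf hg
    rcases Sym2.eq_iff.1 he with ⟨rfl, rfl⟩ | ⟨rfl, rfl⟩
    · exact ⟨hf, hg⟩
    · exact ⟨hg, hf⟩
  obtain ⟨cover, tri, wf⟩ := hb
  cases h with
  | coprime f g hfg hc =>
    refine ⟨fun a ha b hb hab => ?_, tri, wf⟩
    by_cases he : s(a, b) = s(f, g)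
    · obtain ⟨hf, hg⟩ := mem_of_eq he ha hb
      exact Or.inr (Or.inr (Or.inr (good_of_eq he (coprime f hf g hg hc))))
    · exact (cover a ha b hb hab).imp_left fun h => Finset.mem_erase.2 ⟨he, h⟩
  | triangle f g h hfg ht =>
    obtain ⟨hG, -, -, hle, -, h1, h2⟩ := ht
    refine ⟨fun a ha b hb hab => ?_, fun a b c hmem => ?_, ?_⟩
    · by_cases he : s(a, b) = s(f, g)
      · exact Or.inr (Or.inl ⟨f, g, h, List.mem_cons_self, he⟩)
      · rcases cover a ha b hb hab with h' | ⟨a', b', c', hmem, h'⟩ | h'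
        · exact Or.inl (Finset.mem_erase.2 ⟨he, h'⟩)
        · exact Or.inr (Or.inl ⟨a', b', c', List.mem_cons_of_mem _ hmem, h'⟩)
        · exact Or.inr (Or.inr h')
    · rcases List.mem_cons.1 hmem with h' | h'
      · obtain ⟨rfl, rfl, rfl⟩ : a = f ∧ b = g ∧ c = h := by simpa using h'
        exact ⟨hG, hle⟩
      · exact tri a b c h'
    · refine wellFounded_add_edges wf s(f, g) {s(f, h), s(g, h)} ?_ ?_
      · rintro a b ⟨f', g', h', hmem, rfl, hb⟩
        rcases List.mem_cons.1 hmem with h'' | h''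
        · obtain ⟨rfl, rfl, rfl⟩ : f' = f ∧ g' = g ∧ h' = h := by simpa using h''
          exact Or.inr ⟨rfl, by simpa using hb⟩
        · exact Or.inl ⟨f', g', h', h'', rfl, hb⟩
      · rintro y (rfl | rfl)
        · exact h1
        · exact h2
  | addSPoly f g hfg hc ht =>
    refine ⟨fun a ha b hb hab => ?_, tri, wf⟩
    by_cases he : s(a, b) = s(f, g)
    · exact Or.inr (Or.inr (Or.inl ⟨f, g, he, Finset.mem_insert_self _ _⟩))
    · rcases cover a ha b hb hab with h' | h' | ⟨a', b', h', hmem⟩ | h'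
      · exact Or.inl (Finset.mem_erase.2 ⟨he, h'⟩)
      · exact Or.inr (Or.inl h')
      · exact Or.inr (Or.inr (Or.inl ⟨a', b', h', Finset.mem_insert_of_mem hmem⟩))
      · exact Or.inr (Or.inr (Or.inr h'))
  | remZero p μ hpend hp hdiv =>
    refine ⟨fun a ha b hb hab => ?_, tri, wf⟩
    refine (cover a ha b hb hab).imp_right (Or.imp_right ?_)
    rintro (⟨a', b', h', hmem⟩ | h')
    · by_cases he : sPoly m a' b' = p
      · obtain ⟨ha', hb'⟩ := mem_of_eq h' ha hb
        exact Or.inr (good_of_eq h' (reduced p μ 0 hdiv subset_rfl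
          (Or.inr ⟨0, by simp, dvd_zero _⟩) a' ha' b' hb' he))
      · exact Or.inl ⟨a', b', h', Finset.mem_erase.2 ⟨he, hmem⟩⟩
    · exact Or.inr h'
  | remScalar p μ r hpend hp hdiv hr =>
    refine ⟨fun a ha b hb hab => ?_, tri, wf⟩
    refine (cover a ha b hb hab).imp_right (Or.imp_right ?_)
    rintro (⟨a', b', h', hmem⟩ | h')
    · by_cases he : sPoly m a' b' = p
      · obtain ⟨ha', hb'⟩ := mem_of_eq h' ha hb
        exact Or.inr (good_of_eq h' (reduced p μ _ hdiv subset_rfl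
          (Or.inr ⟨r, rfl, EuclideanDomain.gcd_dvd_left _ _⟩) a' ha' b' hb' he))
      · exact Or.inl ⟨a', b', h', Finset.mem_erase.2 ⟨he, hmem⟩⟩
    · exact Or.inr h'
  | remNew p μ r hpend hp hdiv hr =>
    refine ⟨fun a ha b hb hab => ?_,
      fun a b c h => ⟨Finset.mem_insert_of_mem (tri a b c h).1, (tri a b c h).2⟩, wf⟩
    have old : a ∈ s.G → b ∈ s.G → s(a, b) ∈ s.pending ∨
        (∃ a' b' c', (a', b', c') ∈ s.triangles ∧ s(a, b) = s(a', b')) ∨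
        (∃ a' b', s(a, b) = s(a', b') ∧ sPoly m a' b' ∈ s.S.erase p) ∨ Good a b := by
      intro ha₀ hb₀
      refine (cover a ha₀ b hb₀ hab).imp_right (Or.imp_right ?_)
      rintro (⟨a', b', h', hmem⟩ | h')
      · by_cases he : sPoly m a' b' = p
        · obtain ⟨ha', hb'⟩ := mem_of_eq h' ha hb
          exact Or.inr (good_of_eq h' (reduced p μ r hdiv subset_rfl
            (Or.inl (Finset.mem_insert_self _ _)) a' ha' b' hb' he))
        · exact Or.inl ⟨a', b', h', Finset.mem_erase.2 ⟨he, hmem⟩⟩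
      · exact Or.inr h'
    rcases Finset.mem_insert.1 ha with rfl | ha₀
    · rcases Finset.mem_insert.1 hb with rfl | hb₀
      · exact absurd rfl hab
      · exact Or.inl (Finset.mem_image.2 ⟨b, hb₀, Sym2.eq_swap⟩)
    · rcases Finset.mem_insert.1 hb with rfl | hb₀
      · exact Or.inl (Finset.mem_image.2 ⟨a, ha₀, rfl⟩)
      -- The pending set is overwritten here; nothing is lost, as it was empty.
      · exact (old ha₀ hb₀).imp_left fun h => by simp [hpend] at h

/-- In a final state of the algorithm, all `S`-polynomials reduce after a map of the coefficients
by which the multipliers and the leading coefficients become units, and `f₀` becomes zero. -/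
theorem sPolyReduces_of_final {R : Type*} [CommRing R] [Nontrivial R] {φ : Polynomial K →+* R}
    {F : Finset (MvPolynomial (Fin n) (Polynomial K))} {s t : State n K} (hs : IsInitial F s)
    (hst : Relation.ReflTransGen (Step m) s t) (hpend : t.pending = ∅) (hS : t.S = ∅)
    (hlc : ∀ f ∈ t.G, IsUnit (φ (m.leadingCoeff f))) (hμ : ∀ c ∈ t.mults, IsUnit (φ c))
    (h0 : φ t.f₀ = 0) {f g : MvPolynomial (Fin n) (Polynomial K)} (hf : f ∈ t.G) (hg : g ∈ t.G) :
    SPolyReduces m (map φ '' (t.G : Set (MvPolynomial (Fin n) (Polynomial K))))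
      (map φ f) (map φ g) := by
  set B := map φ '' (t.G : Set (MvPolynomial (Fin n) (Polynomial K))) with hB
  -- Representations are taken in the final basis, so `Good` does not depend on the state, and a
  -- remainder added at any time may be used.
  let Good := fun f g : MvPolynomial (Fin n) (Polynomial K) =>
    SPolyReduces m B (map φ f) (map φ g)
  have hdeg : ∀ f ∈ t.G, m.degree (map φ f) = m.degree f :=
    fun f hf => degree_map_of_ne_zero (hlc f hf).ne_zero
  have hbook : ∀ v, Relation.ReflTransGen (Step m) s v → Relation.ReflTransGen (Step m) v t →
      Bookkeeping m Good v := by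
    intro v hsv
    induction hsv with
    | refl => exact fun _ => Bookkeeping.of_isInitial Good hs
    | tail hsu huv ih =>
      intro hvt
      obtain ⟨hG, hdvd, hm⟩ := reflTransGen_step_mono hvt
      refine (ih (Relation.ReflTransGen.head huv hvt)).step (fun _ _ h => h.symm) huv ?_ ?_
      · intro f hf g hg hc
        refine SPolyReduces.of_coprime (Set.mem_image_of_mem _ (hG hf))
          (Set.mem_image_of_mem _ (hG hg)) ?_
        rw [hdeg f (hG hf), hdeg g (hG hg), hc]
      · rintro p μ r hdiv hμt hr f hf g hg rfl
        refine hdiv.sPolyReduces hlc (huv.mono.1.trans hG) (hG hf) (hG hg)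
          (isUnit_map_of_addMult_subset hdiv.1 hμ (hμt.trans hm)) ?_
        rcases hr with hr | ⟨c, rfl, hc⟩
        · exact Or.inr (hG hr)
        · left
          obtain ⟨a, rfl⟩ := hdvd.trans hc
          rw [map_C, map_mul, h0, zero_mul, C_0]
  obtain ⟨cover, tri, wf⟩ := hbook t hst Relation.ReflTransGen.refl
  -- Well-founded induction along the reliance relation: a disregarded pair is settled after the two
  -- pairs that it relies on.
  have main : ∀ P : Sym2 (MvPolynomial (Fin n) (Polynomial K)), ∀ f ∈ t.G, ∀ g ∈ t.G,
      P = s(f, g) → Good f g := by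
    intro P
    induction P using wf.induction with
    | _ P ih =>
      rintro f hf g hg rfl
      by_cases hfg : f = g
      · subst hfg
        exact SPolyReduces.refl _
      rcases cover f hf g hg hfg with h | ⟨a, b, c, hmem, he⟩ | ⟨a, b, -, h⟩ | h
      · simp [hpend] at h
      · obtain ⟨hc, hle⟩ := tri a b c hmem
        have hab : a ∈ t.G → b ∈ t.G → Good a b := by
          intro ha hb
          refine SPolyReduces.of_triangle (h := map φ c) ?_ ?_
            (ih s(a, c) ⟨a, b, c, hmem, he, Or.inl rfl⟩ a ha c hc rfl)
            (ih s(b, c) ⟨a, b, c, hmem, he, Or.inr rfl⟩ b hb c hc rfl)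
          · rw [leadingCoeff_map_of_ne_zero (hlc c hc).ne_zero]
            exact hlc c hc
          · rw [hdeg a ha, hdeg b hb, hdeg c hc]
            exact hle
        rcases Sym2.eq_iff.1 he with ⟨rfl, rfl⟩ | ⟨rfl, rfl⟩
        · exact hab hf hg
        · exact (hab hg hf).symm
      · simp [hS] at h
      · exact h
  exact main _ f hf g hg rfl

/-- The pseudo-basis is in the ideal. -/
theorem mem_of_mem_final {I : Ideal (MvPolynomial (Fin n) (Polynomial K))}
    {F : Finset (MvPolynomial (Fin n) (Polynomial K))} {s t : State n K} (hs : IsInitial F s)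
    (hst : Relation.ReflTransGen (Step m) s t) (hF : ∀ f ∈ F, f ∈ I) :
    ∀ f ∈ t.G, f ∈ I := by
  classical
  have h : (∀ f ∈ t.G, f ∈ I) ∧ (∀ f ∈ t.S, f ∈ I) ∧
      ∀ f g, s(f, g) ∈ t.pending → f ∈ t.G ∧ g ∈ t.G := by
    induction hst with
    | refl =>
      obtain ⟨hG, -, hS, hpend, -, -⟩ := hs
      refine ⟨fun f hf => ?_, by simp [hS], fun f g hfg => ?_⟩
      · rw [hG] at hf
        exact hF f (Finset.mem_filter.1 hf).1
      · rw [hpend, Finset.mem_filter, Finset.mk_mem_sym2_iff] at hfg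
        exact hfg.1
    | tail _ h ih => exact h.mem_ideal ih.1 ih.2.1 ih.2.2
  exact h.1

/-- Generators of the ideal are in the pseudo-basis, or are multiples of the pseudo-eliminant. -/
theorem mem_final_or_dvd {F : Finset (MvPolynomial (Fin n) (Polynomial K))} {s t : State n K}
    (hs : IsInitial F s) (hst : Relation.ReflTransGen (Step m) s t) :
    ∀ f ∈ F, f ∈ t.G ∨ ∃ c, f = C c ∧ t.f₀ ∣ c := by
  classical
  intro f hf
  obtain ⟨hG, hdvd, -⟩ := reflTransGen_step_mono hst
  by_cases hsc : IsScalar f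
  · obtain ⟨c, rfl⟩ := hsc
    exact Or.inr ⟨c, rfl, hdvd.trans (hs.2.1.1 c hf)⟩
  · refine Or.inl (hG ?_)
    rw [hs.1, Finset.mem_filter]
    exact ⟨hf, hsc⟩

end Algorithm

/-! ### Units modulo the compatible part -/

section CompatiblePart

variable {n : ℕ} {K : Type*} [Field K]

theorem compatiblePart_dvd (χ : Polynomial K) (Λ : Finset (Polynomial K)) :
    compatiblePart χ Λ ∣ χ := by
  classical
  by_cases hχ : χ = 0
  · rw [hχ]; exact dvd_zero _
  · exact (Multiset.prod_dvd_prod_of_le (Multiset.filter_le _ _)).trans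
      (UniqueFactorizationMonoid.prod_normalizedFactors hχ).dvd

theorem isCoprime_compatiblePart {χ c : Polynomial K} {Λ : Finset (Polynomial K)} (hc : c ∈ Λ) :
    IsCoprime (compatiblePart χ Λ) c := by
  classical
  unfold compatiblePart
  refine Multiset.prod_induction (fun p => IsCoprime p c) _ (fun a b ha hb => ha.mul_left hb)
    isCoprime_one_left fun p hp => ?_
  exact (Multiset.mem_filter.1 hp).2 c hc

theorem isUnit_mk_of_isCoprime {d c : Polynomial K} (h : IsCoprime d c) :
    IsUnit (Ideal.Quotient.mk (Ideal.span {d}) c) := by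
  obtain ⟨a, b, hab⟩ := h
  refine IsUnit.of_mul_eq_one_right (Ideal.Quotient.mk _ b) ?_
  rw [← map_mul, ← map_one (Ideal.Quotient.mk (Ideal.span {d})), ← hab, map_add, map_mul _ a d,
    Ideal.Quotient.eq_zero_iff_mem.2 (Ideal.mem_span_singleton_self d), mul_zero, zero_add]

/-- The leading coefficients of a pseudo-basis are coprime to the compatible part of a nonzero
pseudo-eliminant. -/
theorem isCoprime_leadingCoeff {m : MonomialOrder (Fin n)}
    {G : Finset (MvPolynomial (Fin n) (Polynomial K))} {χ : Polynomial K}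
    {Λ : Finset (Polynomial K)} (hχ : χ ≠ 0) {f : MvPolynomial (Fin n) (Polynomial K)}
    (hf : f ∈ G) :
    IsCoprime (compatiblePart χ (finalMults m G χ Λ)) (m.leadingCoeff f) := by
  classical
  set d := compatiblePart χ (finalMults m G χ Λ) with hd
  have hdvd : d ∣ χ := compatiblePart_dvd _ _
  have hg : IsCoprime d (EuclideanDomain.gcd (m.leadingCoeff f) χ) := by
    by_cases h0 : (EuclideanDomain.gcd (m.leadingCoeff f) χ).natDegree = 0
    · refine isCoprime_one_right.of_isCoprime_of_dvd_right (IsUnit.dvd ?_)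
      rw [Polynomial.isUnit_iff_degree_eq_zero, Polynomial.degree_eq_natDegree, h0, Nat.cast_zero]
      exact fun h => hχ (EuclideanDomain.gcd_eq_zero_iff.1 h).2
    · refine isCoprime_compatiblePart ?_
      rw [finalMults, Finset.mem_union, Finset.mem_filter, Finset.mem_image]
      exact Or.inr ⟨⟨f, hf, by congr⟩, h0⟩
  -- In a Bézout identity for `d` and `gcd (lc f, χ)`, the gcd is expanded as `lc f * u + χ * v` and
  -- `χ = d * e` is substituted, so that only multiples of `d` and `lc f` remain.
  obtain ⟨e, he⟩ := hdvd
  obtain ⟨a, b, hab⟩ := hg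
  rw [EuclideanDomain.gcd_eq_gcd_ab] at hab
  generalize EuclideanDomain.gcdA (m.leadingCoeff f) χ = u at hab
  generalize EuclideanDomain.gcdB (m.leadingCoeff f) χ = v at hab
  rw [he] at hab
  exact ⟨a + b * e * v, b * u, by linear_combination hab⟩

end CompatiblePart

end PseudoBasis

/-! ### The main theorem -/

theorem lemma6p6 {n : ℕ} {K : Type*} [Field K] (m : MonomialOrder (Fin n))
    (I : Ideal (MvPolynomial (Fin n) (Polynomial K)))
    (hI : PseudoBasis.IsZeroDimensional I)
    (G : Finset (MvPolynomial (Fin n) (Polynomial K))) (χ : Polynomial K)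
    (Λ : Finset (Polynomial K)) (hG : PseudoBasis.IsPseudoBasis m I G χ Λ)
    (d : Polynomial K) (hd : d = PseudoBasis.compatiblePart χ Λ) :
    PseudoBasis.ltIdeal m
        (I.map (PseudoBasis.sigma d) : Set (MvPolynomial (Fin n) (PseudoBasis.ModRing d))) =
      PseudoBasis.ltIdeal m
        (PseudoBasis.modBasis d G : Set (MvPolynomial (Fin n) (PseudoBasis.ModRing d))) ∧
    ∀ f : MvPolynomial (Fin n) (PseudoBasis.ModRing d),
      f ∈ I.map (PseudoBasis.sigma d) ↔
        PseudoBasis.GcdReducesTo m (PseudoBasis.modBasis d G) f 0 := by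
  classical
  open PseudoBasis in
  -- The quotient is trivial when `d` is a unit, that is, when no irreducible factor of `χ` is
  -- compatible.
  rcases subsingleton_or_nontrivial (ModRing d) with hsub | hnt
  · refine ⟨Subsingleton.elim _ _, fun f => ?_⟩
    rw [Subsingleton.elim f 0]
    exact iff_of_true (zero_mem _) (gcdReducesTo_zero_zero m _)
  obtain ⟨F, -, hFI, s, t, hs, hst, hpend, hS, rfl, rfl, rfl⟩ := hG
  have hφd : ∀ c, d ∣ c → Ideal.Quotient.mk (Ideal.span {d}) c = 0 := fun c hc =>
    Ideal.Quotient.eq_zero_iff_mem.2 (Ideal.mem_span_singleton.2 hc)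
  have hdχ : d ∣ t.f₀ := hd ▸ compatiblePart_dvd _ _
  -- The compatible part of `0` is `1`, so a nontrivial `ModRing d` forces `χ ≠ 0`; the
  -- zero-dimensionality of `I` is not needed for this.
  have hχ : t.f₀ ≠ 0 := by
    intro h0
    have h1 : d = 1 := by rw [hd, h0]; simp [compatiblePart]
    exact one_ne_zero ((map_one (Ideal.Quotient.mk (Ideal.span {d}))).symm.trans
      (hφd 1 (h1 ▸ dvd_rfl)))
  have hlc : ∀ f ∈ t.G, IsUnit (Ideal.Quotient.mk (Ideal.span {d}) (m.leadingCoeff f)) :=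
    fun f hf => isUnit_mk_of_isCoprime (hd ▸ isCoprime_leadingCoeff hχ hf)
  have hμ : ∀ c ∈ t.mults, IsUnit (Ideal.Quotient.mk (Ideal.span {d}) c) := fun c hc =>
    isUnit_mk_of_isCoprime (hd ▸ isCoprime_compatiblePart (Finset.mem_union_left _ hc))
  have hB : (modBasis d t.G : Set (MvPolynomial (Fin n) (ModRing d))) = sigma d '' t.G := by
    rw [modBasis, Finset.coe_image]
  have hBI : ∀ b ∈ modBasis d t.G, b ∈ I.map (sigma d) := by
    intro b hb
    obtain ⟨f, hf, rfl⟩ := Finset.mem_image.1 hb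
    exact Ideal.mem_map_of_mem _
      (mem_of_mem_final hs hst (fun f hf => hFI ▸ Ideal.subset_span hf) f hf)
  have hspan : I.map (sigma d) ≤
      Ideal.span (modBasis d t.G : Set (MvPolynomial (Fin n) (ModRing d))) := by
    rw [← hFI, Ideal.map_span, Ideal.span_le]
    rintro _ ⟨f, hf, rfl⟩
    -- A generator in `K[x₁]` is a multiple of `χ`, hence of `d`, and vanishes in the quotient.
    rcases mem_final_or_dvd hs hst f hf with h | ⟨c, rfl, hc⟩
    · exact Ideal.subset_span (hB ▸ Set.mem_image_of_mem _ h)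
    · have : sigma d (MvPolynomial.C c : MvPolynomial (Fin n) (Polynomial K)) = 0 := by
        rw [sigma, MvPolynomial.map_C, hφd c (hdχ.trans hc), MvPolynomial.C_0]
      rw [this]
      exact zero_mem _
  have hu : ∀ b ∈ (modBasis d t.G : Set (MvPolynomial (Fin n) (ModRing d))),
      IsUnit (m.leadingCoeff b) := by
    rw [hB]
    rintro _ ⟨f, hf, rfl⟩
    rw [sigma, leadingCoeff_map_of_ne_zero (hlc f hf).ne_zero]
    exact hlc f hf
  have hred : ∀ b ∈ (modBasis d t.G : Set (MvPolynomial (Fin n) (ModRing d))),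
      ∀ c ∈ (modBasis d t.G : Set (MvPolynomial (Fin n) (ModRing d))),
      SPolyReduces m (modBasis d t.G : Set (MvPolynomial (Fin n) (ModRing d))) b c := by
    rw [hB]
    rintro _ ⟨f, hf, rfl⟩ _ ⟨g, hg, rfl⟩
    exact sPolyReduces_of_final hs hst hpend hS hlc hμ (hφd _ hdχ) hf hg
  have hrep := fun f (hf : f ∈ I.map (sigma d)) =>
    mem_repSpan_degree_of_mem_span hu hred (hspan hf)
  refine ⟨le_antisymm ?_ (Ideal.span_mono (Set.image_mono hBI)), fun f => ⟨fun hf =>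
    gcdReducesTo_zero_of_mem_repSpan m (hrep f hf), ?_⟩⟩
  · refine Ideal.span_le.2 ?_
    rintro _ ⟨f, hf, rfl⟩
    by_cases hf0 : f = 0
    · rw [hf0, m.leadingTerm_zero]
      exact zero_mem _
    obtain ⟨b, hb, hle⟩ := exists_degree_le_of_mem_repSpan hf0 (hrep f hf)
    exact leadingTerm_mem_ltIdeal m hb (hu b hb) hle
  · rintro ⟨u, h, ⟨u, rfl⟩, hsum, -, -⟩
    rw [add_zero] at hsum
    have h1 : f = MvPolynomial.C (↑u⁻¹ : ModRing d) * ∑ b ∈ modBasis d t.G, h b * b := by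
      rw [← hsum, ← mul_assoc, ← map_mul, Units.inv_mul, map_one, one_mul]
    rw [h1]
    exact Ideal.mul_mem_left _ _ (Ideal.sum_mem _ fun b hb => Ideal.mul_mem_left _ _ (hBI b hb))
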